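/- **Setting.** Let $G=(V,E)$ be a finite directed graph with source $s$ and target $t$. Every edge $e$ has a lazy estimate $\hat w(e)>0$ and a true weight $w(e)$, where $w(e)=\hat w(e)$ if $e$ is collision-free and $w(e)=\infty$ if $e$ is in collision. Assume that no two distinct simple paths of $G$ starting at $s$ have the same total lazy weight. Fix a lookahead $\alpha\in\{1,2,\dots\}\cup\{\infty\}$ and a greediness $\beta\in\mathbb N$ with $1\le\beta\le\alpha$. **The algorithm LRA\* with lookahead $\alpha$ and greediness $\beta$.** It maintains a tree $T$ of paths from $s$, with at most one node per vertex. A node $\tau$ at a vertex $v$ stands for a path $P[\tau]$ from $s$ to $v$, which is split into a head (its longest initial part consisting of evaluated edges) and a tail (the rest). The budget $b[\tau]$ is the number of edges of the tail, and the key of $\tau$ is $w(\text{head})+\hat w(\text{tail})$. Edges found in collision are removed from the graph. * *Extending.* As long as possible, take a node $\tau\in T$ at a vertex $u\ne t$ with $b[\tau]<\alpha$ and a remaining edge $(u,v)$ such that $v$ has no node in $T$, or the path $P[\tau]\cdot(u,v)$ has a smaller key than the node of $v$; make $P[\tau]\cdot(u,v)$ the node of $v$, deleting the previous node of $v$ and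 its descendants. These operations may be done in any order. * *Start.* $T$ consists of the root $s$ only, no edge is evaluated, and $T$ is extended. * *Stopping.* A frontier node is a node of $T$ with budget $\alpha$, or the node of $t$. The algorithm stops when $T$ contains a node of $t$ with budget $0$ (success), or when there is no frontier node (failure). * *Iteration.* Otherwise choose a frontier node $\tau$ of minimal key and evaluate the first $\beta$ edges of its tail (all of them if there are fewer), one after the other, stopping at the first edge found in collision. Remove from $T$ all nodes whose path uses a removed edge, update heads, tails, budgets and keys, and extend $T$ again (this rewires the removed nodes to their best parents). **Lemma.** Let $1\le\beta\le\alpha_2<\alpha_1\le\infty$ with $\beta$ an integer and $\alpha_1\ge\alpha_2+\beta-1$. Then LRA\* with greediness $\beta$ has complete (terminating) runs with lookahead $\alpha_1$ and with lookahead $\alpha_2$, and if $E_i$ is the set of edges evaluated in any complete run with lookahead $\alpha_i$ and greediness $\beta$ $(i=1,2)$, then $E_1\subseteq E_2$. -/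

import Mathlib

open scoped NNReal ENNReal

/-- A shortest-path problem with expensive edges on a directed graph: a source, a target, a lazy
estimate `lazyWeight` of the edge weights and the true weights `weight`.  The estimate is tight on
the edges that are not in collision; the edges in collision have weight `∞`. -/
structure LazyProblem (V : Type*) where
  graph : Digraph V
  source : V
  target : V
  lazyWeight : V × V → ℝ≥0
  weight : V × V → ℝ≥0∞
  lazyWeight_pos : ∀ u v, graph.Adj u v → 0 < lazyWeight (u, v)
  weight_eq : ∀ u v, graph.Adj u v →
    weight (u, v) = (lazyWeight (u, v) : ℝ≥0∞) ∨ weight (u, v) = ∞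

namespace LazyProblem

variable {V : Type*} (P : LazyProblem V)

/-- The consecutive pairs (the edges) of a sequence of vertices. -/
def edges (p : List V) : List (V × V) := p.zip p.tail

/-- `p` is a path of the graph that starts at the source and repeats no vertex. -/
def IsSimplePathFromSource (p : List V) : Prop :=
  p.head? = some P.source ∧ p.IsChain P.graph.Adj ∧ p.Nodup

/-- The lazy cost of a list of edges. -/
noncomputable def lazyCost (l : List (V × V)) : ℝ≥0 := (l.map P.lazyWeight).sum

/-- The true cost of a list of edges. -/
noncomputable def trueCost (l : List (V × V)) : ℝ≥0∞ := (l.map P.weight).sum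

/-- No two distinct simple paths from the source have the same (lazy) weight. -/
def DistinctPathWeights : Prop :=
  ∀ p q : List V, P.IsSimplePathFromSource p → P.IsSimplePathFromSource q →
    P.lazyCost (edges p) = P.lazyCost (edges q) → p = q

/-- The edge `e` is collision free: its true weight is the estimated one. -/
def CollisionFree (e : V × V) : Prop := P.weight e = (P.lazyWeight e : ℝ≥0∞)

section Nodes

/-! A node `τ` of the search tree is represented by its path `P[τ]`, a list of vertices from the
source to the vertex of `τ`; its parent is the path without its last vertex.  The other entries of
a node are functions of this path and of the set `A` of edges evaluated so far. -/

open Classical in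
/-- The edges of the evaluated part `P[τ]_head`: the longest initial part of the path all of whose
edges have been evaluated. -/
noncomputable def headEdges (A : Set (V × V)) (p : List V) : List (V × V) :=
  (edges p).takeWhile (fun e => decide (e ∈ A))

open Classical in
/-- The edges of the lazily evaluated part `P[τ]_tail`. -/
noncomputable def tailEdges (A : Set (V × V)) (p : List V) : List (V × V) :=
  (edges p).dropWhile (fun e => decide (e ∈ A))

/-- The budget `b[τ]`. -/
noncomputable def budget (A : Set (V × V)) (p : List V) : ℕ := (tailEdges A p).length

/-- The key `c[τ] + ℓ[τ]` of a node: the true cost of the head plus the lazy cost of the tail. -/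
noncomputable def key (A : Set (V × V)) (p : List V) : ℝ≥0∞ :=
  P.trueCost (headEdges A p) + (P.lazyCost (tailEdges A p) : ℝ≥0∞)

end Nodes

/-- An edge is removed from the graph once it has been evaluated and found in collision. -/
def Removed (A : Set (V × V)) (e : V × V) : Prop := e ∈ A ∧ ¬ P.CollisionFree e

/-- One elementary operation on the search tree `T` (extension of a leaf, or rewiring of a node to
a better parent), with lookahead `α`, after the edges of `A` have been evaluated.  A node `p` of
`T` at a vertex `u` other than the target, whose budget is smaller than `α`, becomes the parent of
the vertex `v`, where `(u, v)` is an edge that has not been removed and `v` is either not yet in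
the tree or has a larger key there.  The previous node of `v` and its descendants are deleted. -/
def Relax (α : ℕ∞) (A : Set (V × V)) (T T' : Set (List V)) : Prop :=
  ∃ (p : List V) (u v : V), p ∈ T ∧ p.getLast? = some u ∧ u ≠ P.target ∧
    (budget A p : ℕ∞) < α ∧ P.graph.Adj u v ∧ ¬ P.Removed A (u, v) ∧
    (∀ q ∈ T, q.getLast? = some v → P.key A (p ++ [v]) < P.key A q) ∧
    T' = insert (p ++ [v]) {q ∈ T | v ∉ q}

/-- `T'` arises from `T` by elementary operations, in any order, carried out until none is
possible: then every successor of a node with budget smaller than `α` is in the tree (all leaves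
are frontier nodes), with a parent that cannot be improved. -/
def Extends (α : ℕ∞) (A : Set (V × V)) (T T' : Set (List V)) : Prop :=
  Relation.ReflTransGen (P.Relax α A) T T' ∧ ∀ T'', ¬ P.Relax α A T' T''

/-- The state of the algorithm at the beginning of an iteration. -/
structure State (V : Type*) where
  tree : Set (List V)
  evaluated : Set (V × V)

/-- The node `p` is in the frontier queue: its budget is `α`, or it is the node of the target. -/
def IsFrontier (α : ℕ∞) (S : State V) (p : List V) : Prop :=
  p ∈ S.tree ∧ ((budget S.evaluated p : ℕ∞) = α ∨ p.getLast? = some P.target)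

/-- The edges evaluated when the node `p` is chosen, with greediness `β`: the first `β` edges of
its tail, one after the other, until one of them is found in collision or the tail ends. -/
def evaluatedOn (β : ℕ) (A : Set (V × V)) (p : List V) : Set (V × V) :=
  {e | ∃ l₁ l₂, (tailEdges A p).take β = l₁ ++ e :: l₂ ∧ ∀ e' ∈ l₁, P.CollisionFree e'}

/-- The tree without the nodes whose path uses a removed edge, that is, without the nodes in the
subtrees that have to be rewired. -/
def prune (A : Set (V × V)) (T : Set (List V)) : Set (List V) :=
  {p ∈ T | ∀ e ∈ edges p, ¬ P.Removed A e}

/-- The target has been reached by a path that is completely evaluated. -/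
def TargetReached (S : State V) : Prop :=
  ∃ p ∈ S.tree, p.getLast? = some P.target ∧ budget S.evaluated p = 0

/-- Initialization: the tree is extended from the node of the source. -/
def IsInitial (α : ℕ∞) (S : State V) : Prop :=
  S.evaluated = ∅ ∧ P.Extends α ∅ {[P.source]} S.tree

/-- One iteration of the main loop: a frontier node of minimal key is chosen, edges along its tail
are evaluated, and the tree is updated, rewired and extended. -/
def Iteration (α : ℕ∞) (β : ℕ) (S S' : State V) : Prop :=
  ¬ P.TargetReached S ∧
  ∃ p, P.IsFrontier α S p ∧
    (∀ q, P.IsFrontier α S q → P.key S.evaluated p ≤ P.key S.evaluated q) ∧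
    S'.evaluated = S.evaluated ∪ P.evaluatedOn β S.evaluated p ∧
    P.Extends α S'.evaluated (P.prune S'.evaluated S.tree) S'.tree

/-- The algorithm stops when the target has been reached (success) or when the frontier queue is
empty (failure). -/
def Halted (α : ℕ∞) (S : State V) : Prop :=
  P.TargetReached S ∨ ∀ p, ¬ P.IsFrontier α S p

/-- `E` is the set of edges evaluated in a complete run of LRA* with lookahead `α` and
greediness `β`. -/
def LRAStarEvaluates (α : ℕ∞) (β : ℕ) (E : Set (V × V)) : Prop :=
  ∃ S₀ S : State V, P.IsInitial α S₀ ∧ Relation.ReflTransGen (P.Iteration α β) S₀ S ∧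
    P.Halted α S ∧ E = S.evaluated

end LazyProblem

/-! On walks without removed edges the key is the lazy cost, so evaluating edges matters only by
deleting some of them and by shrinking tails. Cheapest paths ("geodesics") that survive a deletion
remain cheapest, and distinct path weights make them unique.

A chosen node is always a geodesic (`isGeodesic_of_isChosen`). Hence every evaluated edge continues
an evaluated collision-free geodesic (`EvaluatedAlongGeodesics`), and an evaluated target node is no
dearer than any geodesic with budget at least `α` or ending at the target (`TargetNodeCheapest`).

Compare a run with lookahead `α₁` to the final state of a complete run with lookahead `α₂`, whose
evaluated set is `B`. Suppose the first run chooses `p` and is the first to evaluate an edge `e ∉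
B`. The edges of `p` before `e` are collision-free, and `B` can only contain a removed edge of `p`
if it contains everything before it; so `p` survives as a geodesic of the second graph. At most `β -
1` edges are evaluated before `e` in this iteration, so the budget of `p` drops by at most `β - 1`.
Thus `p` or an initial part of it is a frontier node of the second search, with nonzero budget. The
second run therefore ended in success, with a target node squeezed to the same cost as this frontier
node; by distinctness they coincide, although one is fully evaluated and the other is not. -/

namespace LazyProblem

variable {V : Type*} {P : LazyProblem V} {A B : Set (V × V)} {p q : List V} {u v : V} {α : ℕ∞}
  {β : ℕ} {S S' : State V}

/-! ### Edge lists, costs and budgets. -/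

theorem edges_concat (h : p.getLast? = some u) (v : V) :
    edges (p ++ [v]) = edges p ++ [(u, v)] := by
  induction p with
  | nil => simp at h
  | cons a p ih =>
    cases p with
    | nil => simp_all [edges]
    | cons b p =>
      have := ih (by simpa using h)
      simp_all [edges]

/-- The lazy cost of the path `p`. -/
noncomputable def cost (P : LazyProblem V) (p : List V) : ℝ≥0 := P.lazyCost (edges p)

theorem cost_concat (h : p.getLast? = some u) (v : V) :
    P.cost (p ++ [v]) = P.cost p + P.lazyWeight (u, v) := by
  simp [cost, lazyCost, edges_concat h]

@[simp] theorem edges_singleton (a : V) : edges [a] = [] := rfl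

@[simp] theorem cost_singleton (a : V) : P.cost [a] = 0 := by simp [cost, lazyCost]

theorem headEdges_append_tailEdges (A : Set (V × V)) (p : List V) :
    headEdges A p ++ tailEdges A p = edges p := List.takeWhile_append_dropWhile

theorem mem_of_mem_headEdges {e : V × V} (h : e ∈ headEdges A p) : e ∈ A := by
  simpa using List.mem_takeWhile_imp h

theorem budget_eq_zero_iff : budget A p = 0 ↔ ∀ e ∈ edges p, e ∈ A := by
  simp [budget, tailEdges, List.dropWhile_eq_nil_iff]

theorem length_dropWhile_le_of_imp {β : Type*} {f g : β → Bool} (h : ∀ x, f x → g x)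
    (l : List β) : (l.dropWhile g).length ≤ (l.dropWhile f).length := by
  induction l with
  | nil => simp
  | cons a l ih =>
    by_cases hf : f a
    · simpa [hf, h a hf] using ih
    · by_cases hg : g a
      · simp only [List.dropWhile_cons, hg, hf, if_true]
        exact ((List.dropWhile_suffix g).length_le).trans (by simp)
      · simp [hf, hg]

theorem budget_anti (h : A ⊆ B) (p : List V) : budget B p ≤ budget A p :=
  length_dropWhile_le_of_imp (fun x hx => by simpa using h (by simpa using hx)) _

theorem length_dropWhile_concat_le {β : Type*} (f : β → Bool) (l : List β) (a : β) :
    ((l ++ [a]).dropWhile f).length ≤ (l.dropWhile f).length + 1 := by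
  induction l with
  | nil => by_cases h : f a <;> simp [h]
  | cons b l ih => by_cases h : f b <;> simp_all

theorem budget_concat_le (h : p.getLast? = some u) (v : V) :
    budget A (p ++ [v]) ≤ budget A p + 1 := by
  simpa [budget, tailEdges, edges_concat h] using length_dropWhile_concat_le _ _ _

theorem eq_false_of_dropWhile_eq_cons {β : Type*} {f : β → Bool} {l r : List β} {a : β}
    (h : l.dropWhile f = a :: r) : f a = false := by
  have := List.head?_dropWhile_not f l
  rwa [h] at this

theorem notMem_of_tailEdges_eq_cons {e : V × V} {l : List (V × V)} (h : tailEdges A p = e :: l) :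
    e ∉ A := by
  simpa using eq_false_of_dropWhile_eq_cons h

/-! ### Walks in the remaining graph. -/

/-- `p` is a walk from the source to `u` whose edges are not removed and which does not pass
through the target before its end. -/
inductive IsWalk (P : LazyProblem V) (A : Set (V × V)) : List V → V → Prop
  | source : IsWalk P A [P.source] P.source
  | snoc {p : List V} {u v : V} : IsWalk P A p u → u ≠ P.target → P.graph.Adj u v →
      ¬ P.Removed A (u, v) → IsWalk P A (p ++ [v]) v

theorem IsWalk.getLast? (h : P.IsWalk A p u) : p.getLast? = some u := by
  cases h <;> simp

theorem IsWalk.head? (h : P.IsWalk A p u) : p.head? = some P.source := by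
  induction h with
  | source => rfl
  | snoc _ _ _ _ ih => simp [List.head?_append, ih]

theorem IsWalk.isChain (h : P.IsWalk A p u) : p.IsChain P.graph.Adj := by
  induction h with
  | source => simp
  | snoc hp _ hadj _ ih =>
    refine List.isChain_append.2 ⟨ih, by simp, ?_⟩
    simpa [hp.getLast?] using hadj

theorem IsWalk.not_removed (h : P.IsWalk A p u) : ∀ e ∈ edges p, ¬ P.Removed A e := by
  induction h with
  | source => simp
  | snoc hp _ _ hr ih =>
    intro e he
    rw [edges_concat hp.getLast?, List.mem_append, List.mem_singleton] at he
    rcases he with he | rfl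
    exacts [ih e he, hr]

theorem IsWalk.transfer (h : P.IsWalk A p u) (hB : ∀ e ∈ edges p, ¬ P.Removed B e) :
    P.IsWalk B p u := by
  induction h with
  | source => exact .source
  | snoc hp ht hadj hr ih =>
    rw [edges_concat hp.getLast?] at hB
    exact .snoc (ih fun e he => hB e (by simp [he])) ht hadj (hB _ (by simp))

theorem IsWalk.anti (h : P.IsWalk B p u) (hAB : A ⊆ B) : P.IsWalk A p u :=
  h.transfer fun e he hr => h.not_removed e he ⟨hAB hr.1, hr.2⟩

theorem IsWalk.exists_prefix (h : P.IsWalk A p u) {w : V} (hw : w ∈ p) :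
    ∃ q, q <+: p ∧ P.IsWalk A q w ∧ P.cost q ≤ P.cost p := by
  induction h with
  | source =>
    obtain rfl : w = P.source := by simpa using hw
    exact ⟨_, List.prefix_rfl, .source, le_rfl⟩
  | @snoc p u v hp ht hadj hr ih =>
    rcases List.mem_append.1 hw with hw | hw
    · obtain ⟨q, hq, hqw, hc⟩ := ih hw
      exact ⟨q, hq.trans (List.prefix_append _ _), hqw,
        hc.trans (by simp [cost_concat hp.getLast?])⟩
    · obtain rfl : w = v := by simpa using hw
      exact ⟨_, List.prefix_rfl, .snoc hp ht hadj hr, le_rfl⟩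

theorem lazyCost_eq_trueCost {l : List (V × V)} (h : ∀ e ∈ l, P.CollisionFree e) :
    P.trueCost l = (P.lazyCost l : ℝ≥0∞) := by
  induction l with
  | nil => simp [trueCost, lazyCost]
  | cons e l ih =>
    have h1 : P.weight e = P.lazyWeight e := h e (by simp)
    have h2 := ih fun x hx => h x (by simp [hx])
    simp_all [trueCost, lazyCost]

theorem IsWalk.collisionFree (h : P.IsWalk A p u) {e : V × V} (he : e ∈ edges p) (heA : e ∈ A) :
    P.CollisionFree e :=
  not_not.1 fun hc => h.not_removed e he ⟨heA, hc⟩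

/-- Evaluated edges that are not removed have their estimated weight. Keys can thus be compared
across different evaluated sets. -/
theorem IsWalk.key_eq (h : P.IsWalk A p u) : P.key A p = (P.cost p : ℝ≥0∞) := by
  have hH : ∀ e ∈ headEdges A p, P.CollisionFree e := fun e he =>
    h.collisionFree (by rw [← headEdges_append_tailEdges A p]; simp [he]) (mem_of_mem_headEdges he)
  rw [key, lazyCost_eq_trueCost hH, cost, ← headEdges_append_tailEdges A p]
  simp [lazyCost]

/-! ### Geodesics. -/

/-- `p` is a walk from the source to `u` each of whose initial parts is a cheapest walk. -/
inductive IsGeodesic (P : LazyProblem V) (A : Set (V × V)) : List V → V → Prop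
  | source : IsGeodesic P A [P.source] P.source
  | snoc {p : List V} {u v : V} : IsGeodesic P A p u → u ≠ P.target → P.graph.Adj u v →
      ¬ P.Removed A (u, v) → (∀ q, P.IsWalk A q v → P.cost (p ++ [v]) ≤ P.cost q) →
      IsGeodesic P A (p ++ [v]) v

theorem IsGeodesic.isWalk (h : P.IsGeodesic A p u) : P.IsWalk A p u := by
  induction h with
  | source => exact .source
  | snoc _ ht hadj hr _ ih => exact .snoc ih ht hadj hr

theorem IsGeodesic.cost_le (h : P.IsGeodesic A p u) (hq : P.IsWalk A q u) :
    P.cost p ≤ P.cost q := by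
  cases h with
  | source => simp
  | snoc _ _ _ _ hle => exact hle q hq

/-- Cutting at an earlier visit to the same vertex would give a strictly cheaper walk. Simplicity is
what makes the distinctness assumption applicable. -/
theorem IsGeodesic.nodup (h : P.IsGeodesic A p u) : p.Nodup := by
  induction h with
  | source => simp
  | @snoc p u v hp ht hadj hr hle ih =>
    have hv : v ∉ p := fun hv => by
      obtain ⟨q, -, hq, hc⟩ := hp.isWalk.exists_prefix hv
      have := (hle q hq).trans hc
      rw [cost_concat hp.isWalk.getLast?] at this
      exact absurd this (not_le.2 (lt_add_of_pos_right _ (P.lazyWeight_pos u v hadj)))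
    exact List.nodup_append.2 ⟨ih, by simp, by simpa using fun a ha (h : a = v) => hv (h ▸ ha)⟩

theorem IsGeodesic.transfer (h : P.IsGeodesic A p u) (hB : ∀ e ∈ edges p, ¬ P.Removed B e)
    (hBA : ∀ q v, P.IsWalk B q v → P.IsWalk A q v) : P.IsGeodesic B p u := by
  induction h with
  | source => exact .source
  | snoc hp ht hadj hr hle ih =>
    rw [edges_concat hp.isWalk.getLast?] at hB
    exact .snoc (ih fun e he => hB e (by simp [he])) ht hadj (hB _ (by simp))
      fun q hq => hle q (hBA _ _ hq)

theorem IsWalk.eq_of_cost_eq (hP : P.DistinctPathWeights) {A B : Set (V × V)}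
    (hp : P.IsWalk A p u) (hq : P.IsWalk B q v) (hp' : p.Nodup) (hq' : q.Nodup)
    (h : P.cost p = P.cost q) : p = q :=
  hP p q ⟨hp.head?, hp.isChain, hp'⟩ ⟨hq.head?, hq.isChain, hq'⟩ h

/-- A geodesic splits at each of its edges. -/
theorem IsGeodesic.exists_split (h : P.IsGeodesic A p u) {l r : List (V × V)} {a b : V}
    (he : edges p = l ++ (a, b) :: r) :
    ∃ q, P.IsGeodesic A q a ∧ edges q = l ∧ a ≠ P.target ∧ P.IsGeodesic A (q ++ [b]) b ∧
      (r = [] → p = q ++ [b]) ∧ (b = P.target → r = []) := by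
  induction h generalizing r with
  | source => simp at he
  | @snoc p u v hp ht hadj hr hle ih =>
    rw [edges_concat hp.isWalk.getLast?] at he
    rcases List.eq_nil_or_concat r with rfl | ⟨r, x, rfl⟩
    · obtain ⟨h1, h2⟩ := List.append_inj' he rfl
      obtain ⟨rfl, rfl⟩ : u = a ∧ v = b := by simpa using h2
      exact ⟨p, hp, h1, ht, .snoc hp ht hadj hr hle, fun _ => rfl, fun _ => rfl⟩
    · have he' : edges p ++ [(u, v)] = (l ++ (a, b) :: r) ++ [x] := by simpa using he
      obtain ⟨h1, h2⟩ := List.append_inj' he' rfl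
      obtain ⟨q, hq, hl, ha, hb, hr1, hr2⟩ := ih h1
      refine ⟨q, hq, hl, ha, hb, by simp, fun hbt => ?_⟩
      -- If the edge entered the target, `p` would already end there and could not be extended.
      have h3 := hr1 (hr2 hbt)
      have h4 := hp.isWalk.getLast?
      rw [h3] at h4
      exact absurd (by simpa using h4.symm) (hbt ▸ ht)

/-! ### Search trees and termination of the extension. -/

/-- The search tree is closed under parents, its inner nodes have budget smaller than `α` and are
not at the target, and it has at most one node for each vertex. -/
structure IsSearchTree (P : LazyProblem V) (α : ℕ∞) (A : Set (V × V)) (T : Set (List V)) :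
    Prop where
  source_mem : [P.source] ∈ T
  parent : ∀ p ∈ T, p = [P.source] ∨ ∃ q u v, p = q ++ [v] ∧ q ∈ T ∧ q.getLast? = some u ∧
    u ≠ P.target ∧ P.graph.Adj u v ∧ ¬ P.Removed A (u, v) ∧ (budget A q : ℕ∞) < α ∧ v ∉ q
  unique : ∀ p ∈ T, ∀ q ∈ T, p.getLast? = q.getLast? → p = q

namespace IsSearchTree

variable {T T' : Set (List V)}

@[elab_as_elim]
theorem induction (hT : P.IsSearchTree α A T)
    {C : ∀ p u, p ∈ T → p.getLast? = some u → Prop}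
    (source : C [P.source] P.source hT.source_mem rfl)
    (snoc : ∀ q u v (hq : q ∈ T) (hu : q.getLast? = some u), u ≠ P.target → P.graph.Adj u v →
      ¬ P.Removed A (u, v) → (budget A q : ℕ∞) < α → v ∉ q → ∀ hqv : q ++ [v] ∈ T, C q u hq hu →
      C (q ++ [v]) v hqv (by simp)) (p : List V) (u : V) (hp : p ∈ T)
    (hu : p.getLast? = some u) : C p u hp hu := by
  induction hl : p.length generalizing p u with
  | zero => exact absurd hu (by simp [List.length_eq_zero_iff.1 hl])
  | succ n ih =>
    rcases hT.parent p hp with rfl | ⟨q, u', v, rfl, hq, hu', ht, hadj, hr, hb, hv⟩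
    · obtain rfl : P.source = u := by simpa using hu
      exact source
    · obtain rfl : v = u := by simpa using hu
      exact snoc q u' v hq hu' ht hadj hr hb hv hp (ih q u' hq hu' (by simpa using hl))

theorem isWalk (hT : P.IsSearchTree α A T) (hp : p ∈ T) (hu : p.getLast? = some u) :
    P.IsWalk A p u := by
  induction p, u, hp, hu using hT.induction with
  | source => exact .source
  | snoc q u v hq hu ht hadj hr hb hv hqv ih => exact .snoc ih ht hadj hr

theorem exists_isWalk (hT : P.IsSearchTree α A T) (hp : p ∈ T) : ∃ u, P.IsWalk A p u := by
  rcases hT.parent p hp with rfl | ⟨q, u, v, rfl, -⟩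
  · exact ⟨_, .source⟩
  · exact ⟨v, hT.isWalk hp (by simp)⟩

theorem nodup (hT : P.IsSearchTree α A T) (hp : p ∈ T) : p.Nodup := by
  obtain ⟨u, hu⟩ := hT.exists_isWalk hp
  replace hu := hu.getLast?
  induction p, u, hp, hu using hT.induction with
  | source => simp
  | snoc q u v hq hu ht hadj hr hb hv hqv ih =>
    exact List.nodup_append.2 ⟨ih, by simp, by simpa using fun a ha (h : a = v) => hv (h ▸ ha)⟩

theorem budget_le (hT : P.IsSearchTree α A T) (hp : p ∈ T) : (budget A p : ℕ∞) ≤ α := by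
  rcases hT.parent p hp with rfl | ⟨q, u, v, rfl, hq, hu, ht, hadj, hr, hb, hv⟩
  · simp [budget, tailEdges]
  · calc (budget A (q ++ [v]) : ℕ∞) ≤ (budget A q : ℕ∞) + 1 := by
          exact_mod_cast budget_concat_le hu v
      _ ≤ α := Order.add_one_le_of_lt hb

theorem prefix_mem (hT : P.IsSearchTree α A T) (hp : p ∈ T) (hq : q <+: p) (hne : q ≠ []) :
    q ∈ T := by
  obtain ⟨u, hu⟩ := hT.exists_isWalk hp
  replace hu := hu.getLast?
  induction p, u, hp, hu using hT.induction with
  | source =>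
    have := hT.source_mem
    rcases List.prefix_cons_iff.1 hq with rfl | ⟨t, rfl, ht⟩
    · exact absurd rfl hne
    · simpa [List.prefix_nil.1 ht] using this
  | snoc q' u v hq' hu ht hadj hr hb hv hqv ih =>
    rcases List.prefix_concat_iff.1 hq with rfl | h
    exacts [hqv, ih h]

/-- An elementary operation puts a new node into the tree and deletes only more expensive ones. -/
theorem of_relax (hT : P.IsSearchTree α A T) (h : P.Relax α A T T') :
    P.IsSearchTree α A T' ∧ ∃ p ∈ T', p ∉ T ∧ ∀ q ∈ T, P.cost q ≤ P.cost p → q ∈ T' := by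
  obtain ⟨p, u, v, hp, hu, ht, hb, hadj, hr, hlt, rfl⟩ := h
  have hpw := hT.isWalk hp hu
  have hpv := IsWalk.snoc hpw ht hadj hr
  -- A deleted node has the replaced node of `v` as an initial part, so it costs at least as much as
  -- that node.
  have hmem : ∀ q ∈ T, v ∈ q → P.cost (p ++ [v]) < P.cost q := fun q hq hvq => by
    obtain ⟨w, hw⟩ := hT.exists_isWalk hq
    obtain ⟨q', hpre, hq', hc⟩ := hw.exists_prefix hvq
    have := hlt q' (hT.prefix_mem hq hpre fun h => by simpa [h] using hq'.getLast?) hq'.getLast?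
    rw [hpv.key_eq, hq'.key_eq, ENNReal.coe_lt_coe] at this
    exact this.trans_le hc
  have hvp : v ∉ p := fun hvp => by
    have := hmem p hp hvp
    rw [cost_concat hu] at this
    exact absurd this (by simp)
  refine ⟨⟨Or.inr ⟨hT.source_mem, fun h => ?_⟩, ?_, ?_⟩, p ++ [v], Or.inl rfl, fun h => ?_, ?_⟩
  · simpa using hmem _ hT.source_mem h
  · rintro q (rfl | ⟨hq, hvq⟩)
    · exact Or.inr ⟨p, u, v, rfl, Or.inr ⟨hp, hvp⟩, hu, ht, hadj, hr, hb, hvp⟩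
    · rcases hT.parent q hq with rfl | ⟨q', u', v', rfl, hq', h⟩
      · exact Or.inl rfl
      · exact Or.inr ⟨q', u', v', rfl, Or.inr ⟨hq', fun h => hvq (by simp [h])⟩, h⟩
  · rintro q (rfl | ⟨hq, hvq⟩) r (rfl | ⟨hr, hvr⟩) h
    · rfl
    · exact absurd (List.mem_of_getLast? (h.symm.trans (by simp))) hvr
    · exact absurd (List.mem_of_getLast? (h.trans (by simp))) hvq
    · exact hT.unique q hq r hr h
  · exact absurd (hmem _ h (by simp)) (lt_irrefl _)
  · exact fun q hq hc => Or.inr ⟨hq, fun hvq => absurd (hmem q hq hvq) (not_lt.2 hc)⟩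

theorem singleton (P : LazyProblem V) (α : ℕ∞) (A : Set (V × V)) :
    P.IsSearchTree α A {[P.source]} :=
  ⟨rfl, fun _ hp => Or.inl hp, fun _ hp _ hq _ => hp.trans hq.symm⟩

/-- Budgets only decrease as edges are evaluated, so inner nodes keep budget below `α`. -/
theorem prune (hT : P.IsSearchTree α A T) (hAB : A ⊆ B) : P.IsSearchTree α B (P.prune B T) := by
  refine ⟨⟨hT.source_mem, by simp⟩, ?_, fun p hp q hq h => hT.unique p hp.1 q hq.1 h⟩
  rintro p ⟨hp, hpr⟩
  rcases hT.parent p hp with rfl | ⟨q, u, v, rfl, hq, hu, ht, hadj, hr, hb, hv⟩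
  · exact Or.inl rfl
  · rw [edges_concat hu] at hpr
    exact Or.inr ⟨q, u, v, rfl, ⟨hq, fun e he => hpr e (by simp [he])⟩, hu, ht, hadj,
      hpr _ (by simp), lt_of_le_of_lt (by exact_mod_cast budget_anti hAB q) hb, hv⟩

theorem of_reflTransGen (hT : P.IsSearchTree α A T)
    (h : Relation.ReflTransGen (P.Relax α A) T T') : P.IsSearchTree α A T' := by
  induction h with
  | refl => exact hT
  | tail _ h ih => exact (ih.of_relax h).1

theorem finite [Finite V] (hT : P.IsSearchTree α A T) : T.Finite := by
  classical
  have := Fintype.ofFinite V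
  have : Finite {l : List V | l.Nodup} := inferInstanceAs (Finite {l : List V // l.Nodup})
  exact (Set.toFinite {l : List V | l.Nodup}).subset fun p hp => hT.nodup hp

theorem exists_extends [Finite V] (hT : P.IsSearchTree α A T) : ∃ T', P.Extends α A T T' := by
  classical
  have := Fintype.ofFinite V
  -- A lexicographic order with cheap paths most significant: an elementary operation adds a path
  -- and deletes only dearer ones. There are finitely many simple paths, so it is well-founded.
  let R : Set {l : List V // l.Nodup} → Set {l : List V // l.Nodup} → Prop := fun X Y =>
    ∃ p ∈ X, p ∉ Y ∧ ∀ q ∈ Y, P.cost q.1 ≤ P.cost p.1 → q ∈ X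
  have hirr : Std.Irrefl R := ⟨fun X ⟨p, h, h', _⟩ => h' h⟩
  have htrans : IsTrans _ R := ⟨by
    rintro X Y Z ⟨p, hpX, hpY, hp⟩ ⟨q, hqY, hqZ, hq⟩
    rcases le_total (P.cost q.1) (P.cost p.1) with h | h
    · exact ⟨q, hp q hqY h, hqZ, fun r hr hrq => hp r (hq r hr hrq) (hrq.trans h)⟩
    · exact ⟨p, hpX, fun hpZ => hpY (hq p hpZ h), fun r hr hrp =>
        hp r (hq r hr (hrp.trans h)) hrp⟩⟩
  have wf := Finite.wellFounded_of_trans_of_irrefl R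
  induction hX : {x : {l : List V // l.Nodup} | x.1 ∈ T} using wf.induction generalizing T with
  | _ X ih =>
    by_cases h : ∃ T', P.Relax α A T T'
    · obtain ⟨T₁, h₁⟩ := h
      obtain ⟨hT₁, p, hp, hpT, hle⟩ := hT.of_relax h₁
      obtain ⟨T', h', hmax⟩ := ih {x | x.1 ∈ T₁} (by
        subst hX
        exact ⟨⟨p, hT₁.nodup hp⟩, hp, hpT, fun q hq hc => hle q.1 hq hc⟩) hT₁ rfl
      exact ⟨T', .head h₁ h', hmax⟩
    · exact ⟨T, .refl, not_exists.1 h⟩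

end IsSearchTree
-- Fully extended states and their chosen nodes.
/-- The tree of `S` is a search tree that admits no further elementary operation. -/
structure IsComplete (P : LazyProblem V) (α : ℕ∞) (S : State V) : Prop where
  isSearchTree : P.IsSearchTree α S.evaluated S.tree
  not_relax : ∀ T, ¬ P.Relax α S.evaluated S.tree T

/-- The node `p` is a frontier node of minimal key. -/
def IsChosen (P : LazyProblem V) (α : ℕ∞) (S : State V) (p : List V) : Prop :=
  P.IsFrontier α S p ∧ ∀ q, P.IsFrontier α S q → P.key S.evaluated p ≤ P.key S.evaluated q

theorem IsInitial.isComplete (h : P.IsInitial α S) : P.IsComplete α S := by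
  obtain ⟨hA, hT, hmax⟩ := h
  exact ⟨hA ▸ (IsSearchTree.singleton P α ∅).of_reflTransGen hT, hA ▸ hmax⟩

namespace IsComplete

theorem isWalk (hS : P.IsComplete α S) (hp : p ∈ S.tree) (hu : p.getLast? = some u) :
    P.IsWalk S.evaluated p u := hS.isSearchTree.isWalk hp hu

theorem next (hS : P.IsComplete α S) (hA : S.evaluated ⊆ S'.evaluated)
    (h : P.Extends α S'.evaluated (P.prune S'.evaluated S.tree) S'.tree) : P.IsComplete α S' :=
  ⟨(hS.isSearchTree.prune hA).of_reflTransGen h.1, h.2⟩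

theorem iteration (hS : P.IsComplete α S) (h : P.Iteration α β S S') : P.IsComplete α S' := by
  obtain ⟨-, p, -, -, hA, hT⟩ := h
  exact hS.next (hA ▸ Set.subset_union_left) hT

theorem exists_node_of_adj (hS : P.IsComplete α S) (hp : p ∈ S.tree) (hu : p.getLast? = some u)
    (ht : u ≠ P.target) (hb : (budget S.evaluated p : ℕ∞) < α) (hadj : P.graph.Adj u v)
    (hr : ¬ P.Removed S.evaluated (u, v)) :
    ∃ q ∈ S.tree, q.getLast? = some v ∧ P.cost q ≤ P.cost (p ++ [v]) := by
  by_contra! h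
  refine hS.not_relax _ ⟨p, u, v, hp, hu, ht, hb, hadj, hr, fun q hq hv => ?_, rfl⟩
  rw [(hS.isWalk hq hv).key_eq, (IsWalk.snoc (hS.isWalk hp hu) ht hadj hr).key_eq,
    ENNReal.coe_lt_coe]
  exact h q hq hv

/-- The end of a walk has a node that is at most as expensive, unless the search has stopped at a
frontier node that is at most as expensive. -/
theorem exists_node_of_isWalk (hS : P.IsComplete α S) (hp : P.IsWalk S.evaluated p u) :
    (∃ q ∈ S.tree, q.getLast? = some u ∧ P.cost q ≤ P.cost p) ∨
      ∃ q, P.IsFrontier α S q ∧ P.cost q ≤ P.cost p := by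
  induction hp with
  | source => exact Or.inl ⟨_, hS.isSearchTree.source_mem, rfl, le_rfl⟩
  | @snoc p u v hp ht hadj hr ih =>
    have hc := cost_concat (P := P) hp.getLast? v
    rcases ih with ⟨q, hq, hu, hqp⟩ | ⟨q, hq, hqp⟩
    · rcases (hS.isSearchTree.budget_le hq).lt_or_eq with hb | hb
      · obtain ⟨r, hr, hv, hrq⟩ := hS.exists_node_of_adj hq hu ht hb hadj hr
        refine Or.inl ⟨r, hr, hv, hrq.trans ?_⟩
        rw [hc, cost_concat hu]
        gcongr
      · exact Or.inr ⟨q, ⟨hq, Or.inl hb⟩, hqp.trans (hc ▸ le_self_add)⟩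
    · exact Or.inr ⟨q, hq, hqp.trans (hc ▸ le_self_add)⟩

/-- A geodesic is in the tree, unless the search has stopped at one of its initial parts. -/
theorem mem_of_isGeodesic (hS : P.IsComplete α S) (hP : P.DistinctPathWeights)
    (hp : P.IsGeodesic S.evaluated p u) :
    p ∈ S.tree ∨ ∃ q w, q ∈ S.tree ∧ P.IsGeodesic S.evaluated q w ∧
      (budget S.evaluated q : ℕ∞) = α ∧ P.cost q ≤ P.cost p ∧ ∀ e ∈ edges q, e ∈ edges p := by
  induction hp with
  | source => exact Or.inl hS.isSearchTree.source_mem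
  | @snoc p u v hp ht hadj hr hle ih =>
    have hu := hp.isWalk.getLast?
    have hc := cost_concat (P := P) hu v
    have he := edges_concat hu v
    rcases ih with h | ⟨q, w, hq, hqw, hb, hqp, hqe⟩
    · rcases (hS.isSearchTree.budget_le h).lt_or_eq with hb | hb
      · obtain ⟨r, hrT, hv, hrq⟩ := hS.exists_node_of_adj h hu ht hb hadj hr
        have hrw := hS.isWalk hrT hv
        have hg := IsGeodesic.snoc hp ht hadj hr hle
        -- The node of `v` costs no more than the geodesic, hence equally much, hence is the
        -- geodesic.
        have := hrw.eq_of_cost_eq hP hg.isWalk (hS.isSearchTree.nodup hrT) hg.nodup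
          (hrq.antisymm (hle r hrw))
        exact Or.inl (this ▸ hrT)
      · exact Or.inr ⟨p, u, h, hp, hb, hc ▸ le_self_add, fun e h => by simp [he, h]⟩
    · exact Or.inr ⟨q, w, hq, hqw, hb, hqp.trans (hc ▸ le_self_add),
        fun e h => by simp [he, hqe e h]⟩

theorem mem_of_isGeodesic_of_evaluated (hS : P.IsComplete α S) (hP : P.DistinctPathWeights)
    (hα : α ≠ 0) (hp : P.IsGeodesic S.evaluated p u) (he : ∀ e ∈ edges p, e ∈ S.evaluated) :
    p ∈ S.tree := by
  rcases hS.mem_of_isGeodesic hP hp with h | ⟨q, w, -, -, hb, -, hqe⟩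
  · exact h
  · rw [budget_eq_zero_iff.2 fun e h => he e (hqe e h)] at hb
    exact absurd hb.symm (by simpa using hα)

theorem cost_le_of_isChosen (hS : P.IsComplete α S) (hp : P.IsChosen α S p)
    (hq : P.IsFrontier α S q) : P.cost p ≤ P.cost q := by
  obtain ⟨u, hu⟩ := hS.isSearchTree.exists_isWalk hp.1.1
  obtain ⟨v, hv⟩ := hS.isSearchTree.exists_isWalk hq.1
  have := hp.2 q hq
  rwa [hu.key_eq, hv.key_eq, ENNReal.coe_le_coe] at this

/-- A competing walk leads either to the unique tree node at its end, which costs no more than the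
walk, or to a frontier node bounding its cost from below; the latter costs at least as much as `p`.
The induction along parents needs the claim for all nodes no dearer than `p`. -/
theorem isGeodesic_of_isChosen (hS : P.IsComplete α S) (hp : P.IsChosen α S p)
    (hu : p.getLast? = some u) : P.IsGeodesic S.evaluated p u := by
  suffices ∀ q v, q ∈ S.tree → q.getLast? = some v → P.cost q ≤ P.cost p →
    P.IsGeodesic S.evaluated q v from this p u hp.1.1 hu le_rfl
  intro q v hq hv
  induction q, v, hq, hv using hS.isSearchTree.induction with
  | source => exact fun _ => .source
  | snoc q u v hq hu ht hadj hr hb hv hqv ih =>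
    intro hc
    refine .snoc (ih (le_trans ?_ hc)) ht hadj hr fun r hrw => ?_
    · rw [cost_concat hu]
      exact le_self_add
    · rcases hS.exists_node_of_isWalk hrw with ⟨x, hx, hxv, hxr⟩ | ⟨x, hx, hxr⟩
      · rwa [← hS.isSearchTree.unique x hx _ hqv (by simp [hxv])]
      · exact hc.trans ((hS.cost_le_of_isChosen hp hx).trans hxr)

theorem cost_le_of_target (hS : P.IsComplete α S) (hp : P.IsChosen α S p)
    (hq : P.IsWalk S.evaluated q P.target) : P.cost p ≤ P.cost q := by
  rcases hS.exists_node_of_isWalk hq with ⟨x, hx, hxt, hxq⟩ | ⟨x, hx, hxq⟩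
  · exact (hS.cost_le_of_isChosen hp ⟨hx, Or.inr hxt⟩).trans hxq
  · exact (hS.cost_le_of_isChosen hp hx).trans hxq

end IsComplete

/-! ### Invariants of a run. -/

/-- Every evaluated edge continues a completely evaluated collision-free geodesic, which it extends
to a geodesic if it is collision-free itself. -/
def EvaluatedAlongGeodesics (P : LazyProblem V) (A : Set (V × V)) : Prop :=
  ∀ u v, (u, v) ∈ A → ∃ q, P.IsGeodesic A q u ∧ (∀ e ∈ edges q, e ∈ A) ∧ u ≠ P.target ∧
    (P.CollisionFree (u, v) → P.IsGeodesic A (q ++ [v]) v)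

/-- A completely evaluated node of the target is at most as expensive as all the geodesics that
are frontier nodes or have frontier nodes as initial parts. -/
def TargetNodeCheapest (P : LazyProblem V) (α : ℕ∞) (S : State V) : Prop :=
  ∀ r ∈ S.tree, r.getLast? = some P.target → budget S.evaluated r = 0 →
    ∀ q w, P.IsGeodesic S.evaluated q w →
      (α ≤ (budget S.evaluated q : ℕ∞) ∨ w = P.target) → P.cost r ≤ P.cost q

theorem IsGeodesic.mono (h : P.IsGeodesic A p u) (hAB : A ⊆ B)
    (hB : ∀ e ∈ edges p, ¬ P.Removed B e) : P.IsGeodesic B p u :=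
  h.transfer hB fun _ _ hq => hq.anti hAB

/-- The position on a path of an edge that is evaluated when the path is chosen. -/
theorem exists_split_of_mem_evaluatedOn {e : V × V} (hw : P.IsWalk A p u)
    (he : e ∈ P.evaluatedOn β A p) :
    ∃ l₁ l₂ r, l₁.length < β ∧
      (tailEdges A p).take β = l₁ ++ e :: l₂ ∧
      edges p = (headEdges A p ++ l₁) ++ e :: (l₂ ++ r) ∧
      ∀ x ∈ headEdges A p ++ l₁, P.CollisionFree x ∧ x ∈ A ∪ P.evaluatedOn β A p := by
  obtain ⟨l₁, l₂, htake, hfree⟩ := he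
  have htail : tailEdges A p = l₁ ++ e :: (l₂ ++ (tailEdges A p).drop β) := by
    conv_lhs => rw [← List.take_append_drop β (tailEdges A p), htake]
    simp
  have hl₁ : ∀ x ∈ l₁, x ∈ P.evaluatedOn β A p := fun x hx => by
    obtain ⟨a, b, rfl⟩ := List.append_of_mem hx
    exact ⟨a, b ++ e :: l₂, by simp [htake], fun y hy => hfree y (by simp [hy])⟩
  have hedges : edges p = (headEdges A p ++ l₁) ++ e :: (l₂ ++ (tailEdges A p).drop β) := by
    rw [← headEdges_append_tailEdges A p]
    conv_lhs => rw [htail]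
    simp
  refine ⟨l₁, l₂, _, ?_, htake, hedges, fun x hx => ?_⟩
  · have := congrArg List.length htake
    simp only [List.length_take, List.length_append, List.length_cons] at this
    omega
  · rcases List.mem_append.1 hx with h | h
    · have hA := mem_of_mem_headEdges h
      exact ⟨hw.collisionFree (by rw [hedges]; simp [h]) hA, Or.inl hA⟩
    · exact ⟨hfree x h, Or.inr (hl₁ x h)⟩

/-- New edges lie on the chosen geodesic, and evaluation stops at the first collision, so the part
before each of them is collision-free. Old witnesses have no edge in collision and survive the
deletions. -/
theorem EvaluatedAlongGeodesics.iteration (hK : P.EvaluatedAlongGeodesics S.evaluated)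
    (hS : P.IsComplete α S) (h : P.Iteration α β S S') :
    P.EvaluatedAlongGeodesics S'.evaluated := by
  obtain ⟨-, p, hp, hmin, hA, -⟩ := h
  have hsub : S.evaluated ⊆ S'.evaluated := hA ▸ Set.subset_union_left
  intro u v huv
  suffices ∃ q, P.IsGeodesic S.evaluated q u ∧
      (∀ e ∈ edges q, P.CollisionFree e ∧ e ∈ S'.evaluated) ∧ u ≠ P.target ∧
      (P.CollisionFree (u, v) → P.IsGeodesic S.evaluated (q ++ [v]) v) by
    obtain ⟨q, hq, he, ht, hfree⟩ := this
    refine ⟨q, hq.mono hsub fun e h hr => hr.2 (he e h).1, fun e h => (he e h).2, ht,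
      fun h => (hfree h).mono hsub fun e he' hr => ?_⟩
    rw [edges_concat hq.isWalk.getLast?, List.mem_append, List.mem_singleton] at he'
    rcases he' with he' | rfl
    exacts [hr.2 (he e he').1, hr.2 h]
  rw [hA] at huv
  rcases huv with huv | huv
  · obtain ⟨q, hq, he, ht, hfree⟩ := hK u v huv
    exact ⟨q, hq, fun e h => ⟨hq.isWalk.collisionFree h (he e h), hsub (he e h)⟩, ht, hfree⟩
  · obtain ⟨w, hw⟩ := hS.isSearchTree.exists_isWalk hp.1
    obtain ⟨l₁, l₂, r, -, -, hedges, hfree⟩ := exists_split_of_mem_evaluatedOn hw huv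
    obtain ⟨q, hq, hl, ht, hqv, -⟩ :=
      (hS.isGeodesic_of_isChosen ⟨hp, hmin⟩ hw.getLast?).exists_split hedges
    exact ⟨q, hq, fun e h => hA ▸ hfree e (hl ▸ h), ht, fun _ => hqv⟩

theorem IsInitial.targetNodeCheapest (h : P.IsInitial α S) : P.TargetNodeCheapest α S := by
  intro r hr _ hb q _ _ _
  rw [budget_eq_zero_iff, h.1] at hb
  have : edges r = [] := List.eq_nil_iff_forall_not_mem.2 fun e he => hb e he
  simp [cost, lazyCost, this]

/-- If the target has just been reached, the last edge of its node is new, so this node is the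
chosen path `p`, now fully evaluated without collision. Minimality of `p` among the previous
frontier nodes gives the bound. -/
theorem TargetNodeCheapest.iteration (hP : P.DistinctPathWeights) (hα : α ≠ 0)
    (hK : P.EvaluatedAlongGeodesics S.evaluated) (hS : P.IsComplete α S)
    (h : P.Iteration α β S S') : P.TargetNodeCheapest α S' := by
  have hS' := hS.iteration h
  obtain ⟨hnot, p, hp, hmin, hA, -⟩ := h
  have hchosen : P.IsChosen α S p := ⟨hp, hmin⟩
  have hsub : S.evaluated ⊆ S'.evaluated := hA ▸ Set.subset_union_left
  intro r hr ht hb q w hq hqw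
  have hrw := hS'.isWalk hr ht
  rw [budget_eq_zero_iff] at hb
  rcases hS'.isSearchTree.parent r hr with rfl | ⟨r', u, v, rfl, hr', hu, -⟩
  · simp
  obtain rfl : v = P.target := by simpa using ht
  have hmem : (u, P.target) ∈ edges (r' ++ [P.target]) := by simp [edges_concat hu]
  have hfree := hrw.collisionFree hmem (hb _ hmem)
  have huv := hb _ hmem
  rw [hA] at huv
  rcases huv with huv | huv
  · obtain ⟨x, hx, he, -, hxt⟩ := hK _ _ huv
    -- Were the last edge old, an evaluated geodesic to the target would already have been in the
    -- tree.
    have hev : ∀ e ∈ edges (x ++ [P.target]), e ∈ S.evaluated := fun e h => by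
      rw [edges_concat hx.isWalk.getLast?, List.mem_append, List.mem_singleton] at h
      rcases h with h | rfl
      exacts [he e h, huv]
    exact absurd ⟨_, hS.mem_of_isGeodesic_of_evaluated hP hα (hxt hfree) hev, by simp,
      budget_eq_zero_iff.2 hev⟩ hnot
  · obtain ⟨y, hy⟩ := hS.isSearchTree.exists_isWalk hp.1
    obtain ⟨l₁, l₂, d, -, htake, hedges, hl⟩ := exists_split_of_mem_evaluatedOn hy huv
    have hpg := hS.isGeodesic_of_isChosen hchosen hy.getLast?
    obtain ⟨x, hx, hxl, -, hxt, hnil, hnil'⟩ := hpg.exists_split hedges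
    have hd := hnil' rfl
    have hpx := hnil hd
    rw [hd] at hedges
    obtain ⟨rfl, -⟩ := List.append_eq_nil_iff.1 hd
    have hall : ∀ e ∈ edges p, P.CollisionFree e ∧ e ∈ S'.evaluated := fun e h => by
      rw [hedges, List.mem_append, List.mem_singleton] at h
      rcases h with h | rfl
      exacts [hA ▸ hl e h, ⟨hfree, hb _ hmem⟩]
    have hpg' : P.IsGeodesic S'.evaluated p P.target :=
      hpx ▸ hxt.mono hsub (hpx ▸ fun e h hr => hr.2 (hall e h).1)
    have hpT := hS'.mem_of_isGeodesic_of_evaluated hP hα hpg' fun e h => (hall e h).2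
    have hrp := hS'.isSearchTree.unique _ hr _ hpT (by simp [hpg'.isWalk.getLast?])
    rw [hrp]
    rcases hqw with hqb | rfl
    -- All edges evaluated in this iteration are collision-free, so the graph is unchanged and `q`
    -- was a geodesic before.
    · have hremoved : ∀ e, P.Removed S'.evaluated e → P.Removed S.evaluated e := fun e he => by
        refine ⟨?_, he.2⟩
        have h := he.1
        rw [hA] at h
        rcases h with h | ⟨m₁, m₂, hm, -⟩
        · exact h
        · have : e ∈ l₁ ++ [(u, P.target)] := by rw [← htake, hm]; simp
          refine absurd (hall e ?_).1 he.2
          rw [hedges]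
          simp only [List.mem_append] at this ⊢
          tauto
      have hqS : P.IsGeodesic S.evaluated q w :=
        hq.transfer (fun e he hr => hq.isWalk.not_removed e he ⟨hsub hr.1, hr.2⟩)
          fun x v hx => hx.transfer fun e he hr => hx.not_removed e he (hremoved e hr)
      rcases hS.mem_of_isGeodesic hP hqS with hqT | ⟨x, y, hxT, -, hxb, hxq, -⟩
      · refine hS.cost_le_of_isChosen hchosen ⟨hqT, Or.inl ?_⟩
        exact (hS.isSearchTree.budget_le hqT).antisymm
          (hqb.trans (by exact_mod_cast budget_anti hsub q))
      · exact (hS.cost_le_of_isChosen hchosen ⟨hxT, Or.inl hxb⟩).trans hxq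
    · exact hpg'.cost_le hq.isWalk

theorem IsInitial.invariants (hP : P.DistinctPathWeights) (hα : α ≠ 0) (hS : P.IsInitial α S)
    (h : Relation.ReflTransGen (P.Iteration α β) S S') :
    P.IsComplete α S' ∧ P.EvaluatedAlongGeodesics S'.evaluated ∧ P.TargetNodeCheapest α S' := by
  induction h with
  | refl =>
    exact ⟨hS.isComplete, fun u v h => by simp [hS.1] at h, hS.targetNodeCheapest⟩
  | tail _ h ih =>
    exact ⟨ih.1.iteration h, ih.2.1.iteration ih.1 h, .iteration hP hα ih.2.1 ih.1 h⟩

/-! ### Comparison of the two lookaheads. -/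

/-- The first edge of a geodesic that is removed later is reached along this geodesic. -/
theorem IsGeodesic.not_removed_or_exists (hP : P.DistinctPathWeights) (hAB : A ⊆ B)
    (hK : P.EvaluatedAlongGeodesics B) (hp : P.IsGeodesic A p u) :
    (∀ e ∈ edges p, ¬ P.Removed B e) ∨
      ∃ l e r, edges p = l ++ e :: r ∧ P.Removed B e ∧ ∀ x ∈ l, x ∈ B := by
  induction hp with
  | source => simp
  | @snoc p u v hp ht hadj hr hle ih =>
    rw [edges_concat hp.isWalk.getLast?]
    rcases ih with h | ⟨l, e, r, he, hr, hl⟩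
    · by_cases huv : P.Removed B (u, v)
      · obtain ⟨q, hq, hqB, -⟩ := hK u v huv.1
        -- `p` survives in the smaller graph, so `p` and `q` are both cheapest to `u` and coincide.
        have hpq := hp.isWalk.eq_of_cost_eq hP hq.isWalk hp.nodup hq.nodup
          ((hp.cost_le (hq.isWalk.anti hAB)).antisymm (hq.cost_le (hp.isWalk.transfer h)))
        exact Or.inr ⟨edges p, (u, v), [], rfl, huv, hpq ▸ hqB⟩
      · refine Or.inl fun e he => ?_
        rcases List.mem_append.1 he with he | he
        · exact h e he
        · rwa [List.mem_singleton.1 he]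
    · exact Or.inr ⟨l, e, r ++ [(u, v)], by simp [he], hr, hl⟩

theorem prefix_of_append_eq {β : Type*} {s : Set β} {a b c d : List β} {e : β}
    (h : a ++ b = c ++ e :: d) (ha : ∀ x ∈ a, x ∈ s) (he : e ∉ s) : a <+: c := by
  rcases List.append_eq_append_iff.1 h with ⟨t, rfl, -⟩ | ⟨t, rfl, ht⟩
  · exact List.prefix_append _ _
  · cases t with
    | nil => simp
    | cons x t =>
      obtain ⟨rfl, -⟩ : e = x ∧ _ := by simpa using ht
      exact absurd (ha e (by simp)) he

/-- An edge that is evaluated with lookahead `α₁` is evaluated with lookahead `α₂`. -/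
theorem Iteration.evaluated_subset (hP : P.DistinctPathWeights) {α₁ α₂ : ℕ∞} (hβ : 1 ≤ β)
    (h₂β : (β : ℕ∞) ≤ α₂) (hα : α₂ + (β : ℕ∞) ≤ α₁ + 1) {S₁ S₁' S₂ : State V}
    (hS₁ : P.IsComplete α₁ S₁) (h : P.Iteration α₁ β S₁ S₁') (hS₂ : P.IsComplete α₂ S₂)
    (hK : P.EvaluatedAlongGeodesics S₂.evaluated) (hJ : P.TargetNodeCheapest α₂ S₂)
    (hhalt : P.Halted α₂ S₂) (hsub : S₁.evaluated ⊆ S₂.evaluated) :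
    S₁'.evaluated ⊆ S₂.evaluated := by
  obtain ⟨-, p, hp, hmin, hA, -⟩ := h
  have hchosen : P.IsChosen α₁ S₁ p := ⟨hp, hmin⟩
  obtain ⟨w, hw⟩ := hS₁.isSearchTree.exists_isWalk hp.1
  have hpg := hS₁.isGeodesic_of_isChosen hchosen hw.getLast?
  rw [hA]
  refine Set.union_subset hsub fun e he => ?_
  by_contra heB
  obtain ⟨l₁, l₂, r, hlen, -, hedges, hfree⟩ := exists_split_of_mem_evaluatedOn hw he
  have hnot : ∀ x ∈ edges p, ¬ P.Removed S₂.evaluated x := by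
    refine (hpg.not_removed_or_exists hP hsub hK).resolve_right ?_
    rintro ⟨l, f, r', hl, hf, hlB⟩
    -- All of `l ++ [f]` lies in the second evaluated set and `e` does not, so `f` precedes `e` and
    -- is collision-free.
    have hpre : l ++ [f] <+: headEdges S₁.evaluated p ++ l₁ :=
      prefix_of_append_eq (s := S₂.evaluated) (b := r') (by rw [← hedges, hl]; simp)
        (fun x hx => by
          rcases List.mem_append.1 hx with hx | hx
          exacts [hlB x hx, List.mem_singleton.1 hx ▸ hf.1]) heB
    exact hf.2 (hfree f (hpre.subset (by simp))).1
  have hpB : P.IsGeodesic S₂.evaluated p w := hpg.mono hsub hnot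
  -- The second head of `p` stops before `e`, so it exceeds the first head by at most `l₁`, and
  -- `l₁.length ≤ β - 1`.
  have hbudget : budget S₁.evaluated p ≤ budget S₂.evaluated p + l₁.length := by
    have h₁ := congrArg List.length (headEdges_append_tailEdges S₁.evaluated p)
    have h₂ := congrArg List.length (headEdges_append_tailEdges S₂.evaluated p)
    have h₃ := (prefix_of_append_eq ((headEdges_append_tailEdges S₂.evaluated p).trans hedges)
      (fun x hx => mem_of_mem_headEdges hx) heB).length_le
    simp only [List.length_append] at h₁ h₂ h₃
    simp only [budget]
    omega
  have hfront : ∃ x y, P.IsFrontier α₂ S₂ x ∧ P.IsGeodesic S₂.evaluated x y ∧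
      (α₂ ≤ (budget S₂.evaluated x : ℕ∞) ∨ y = P.target) ∧ P.cost x ≤ P.cost p ∧
      budget S₂.evaluated x ≠ 0 := by
    rcases hS₂.mem_of_isGeodesic hP hpB with hpT | ⟨x, y, hxT, hx, hxb, hxp, -⟩
    · have hne : budget S₂.evaluated p ≠ 0 := fun h =>
        heB (budget_eq_zero_iff.1 h e (by rw [hedges]; simp))
      rcases hp.2 with hb | ht
      · have hle : α₂ ≤ (budget S₂.evaluated p : ℕ∞) := by
          rw [← hb] at hα
          have : α₂ + (β : ℕ∞) ≤ (budget S₂.evaluated p : ℕ∞) + (β : ℕ∞) :=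
            hα.trans (by exact_mod_cast (by omega :
              budget S₁.evaluated p + 1 ≤ budget S₂.evaluated p + β))
          exact (ENat.add_le_add_iff_right (ENat.natCast_ne_top β)).1 this
        exact ⟨p, w, ⟨hpT, Or.inl ((hS₂.isSearchTree.budget_le hpT).antisymm hle)⟩, hpB,
          Or.inl hle, le_rfl, hne⟩
      · have hwt : w = P.target := by simpa [hw.getLast?] using ht
        exact ⟨p, w, ⟨hpT, Or.inr ht⟩, hpB, Or.inr hwt, le_rfl, hne⟩
    -- Here the budget is `α₂ ≥ β ≥ 1`, hence nonzero.
    · refine ⟨x, y, ⟨hxT, Or.inl hxb⟩, hx, Or.inl hxb.ge, hxp, fun h => ?_⟩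
      rw [← hxb, h] at h₂β
      have : β ≤ 0 := by exact_mod_cast h₂β
      omega
  obtain ⟨x, y, hxF, hx, hxy, hxp, hx0⟩ := hfront
  obtain ⟨z, hzT, hzt, hz0⟩ := hhalt.resolve_right fun h => h x hxF
  have hz := hS₂.isWalk hzT hzt
  -- The target node `z` is also a walk in the larger first graph, which closes the chain `z ≤ x ≤ p
  -- ≤ z` of costs.
  have hpz := hS₁.cost_le_of_target hchosen (hz.anti hsub)
  have hzx := hJ z hzT hzt hz0 x y hx hxy
  exact hx0 (hz.eq_of_cost_eq hP hx.isWalk (hS₂.isSearchTree.nodup hzT) hx.nodup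
    (hzx.antisymm (hxp.trans hpz)) ▸ hz0)

/-! ### Existence of complete runs. -/

theorem IsComplete.exists_iteration [Finite V] (hβ : 1 ≤ β) (hα : α ≠ 0)
    (hS : P.IsComplete α S) (h : ¬ P.Halted α S) :
    ∃ S', P.Iteration α β S S' ∧ S.evaluated ⊂ S'.evaluated := by
  simp only [Halted, not_or, not_forall, not_not] at h
  obtain ⟨hnot, hne⟩ := h
  have hfin : {p | P.IsFrontier α S p}.Finite := hS.isSearchTree.finite.subset fun p hp => hp.1
  obtain ⟨p, hp, hmin⟩ := Set.exists_min_image _ (P.key S.evaluated) hfin hne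
  obtain ⟨T, hT⟩ := (hS.isSearchTree.prune (B := S.evaluated ∪ P.evaluatedOn β S.evaluated p)
    Set.subset_union_left).exists_extends
  refine ⟨⟨T, S.evaluated ∪ P.evaluatedOn β S.evaluated p⟩, ⟨hnot, p, hp, hmin, rfl, hT⟩,
    Set.ssubset_iff_subset_ne.2 ⟨Set.subset_union_left, fun heq => ?_⟩⟩
  -- The chosen tail is nonempty, and `β ≥ 1` makes its first edge a new evaluated edge.
  have hb : budget S.evaluated p ≠ 0 := fun h0 => by
    rcases hp.2 with hb | ht
    · rw [h0] at hb
      exact hα (by simpa using hb.symm)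
    · exact hnot ⟨p, hp.1, ht, h0⟩
  obtain ⟨e, l, hl⟩ := List.exists_cons_of_length_pos (Nat.pos_of_ne_zero hb)
  have he : e ∈ P.evaluatedOn β S.evaluated p := by
    refine ⟨[], l.take (β - 1), ?_, by simp⟩
    obtain ⟨n, rfl⟩ := Nat.exists_eq_add_of_le' hβ
    simp [hl]
  have hmem : e ∈ S.evaluated := by
    rw [heq]
    exact Or.inr he
  exact notMem_of_tailEdges_eq_cons hl hmem

theorem IsComplete.exists_halted [Finite V] (hβ : 1 ≤ β) (hα : α ≠ 0)
    (hS : P.IsComplete α S) :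
    ∃ S', Relation.ReflTransGen (P.Iteration α β) S S' ∧ P.Halted α S' := by
  induction hA : S.evaluated using (wellFounded_gt (α := Set (V × V))).induction
    generalizing S with
  | _ A ih =>
    by_cases h : P.Halted α S
    · exact ⟨S, .refl, h⟩
    · obtain ⟨S₁, h₁, hlt⟩ := hS.exists_iteration hβ hα h
      obtain ⟨S', h', hhalt⟩ := ih S₁.evaluated (hA ▸ hlt) (hS.iteration h₁) rfl
      exact ⟨S', .head h₁ h', hhalt⟩

theorem exists_lraStarEvaluates [Finite V] (P : LazyProblem V) (hβ : 1 ≤ β) (hα : α ≠ 0) :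
    ∃ E, P.LRAStarEvaluates α β E := by
  obtain ⟨T, hT⟩ := (IsSearchTree.singleton P α ∅).exists_extends
  have hS : P.IsInitial α ⟨T, ∅⟩ := ⟨rfl, hT⟩
  obtain ⟨S, h, hhalt⟩ := hS.isComplete.exists_halted hβ hα
  exact ⟨S.evaluated, _, S, hS, h, hhalt, rfl⟩

end LazyProblem

theorem mainTheorem8 {V : Type*} [Finite V] (P : LazyProblem V) (hP : P.DistinctPathWeights)
    (β : ℕ) (hβ : 1 ≤ β) (α₁ α₂ : ℕ∞) (h₁₂ : α₂ < α₁) (h₂β : (β : ℕ∞) ≤ α₂)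
    (hα : α₂ + (β : ℕ∞) ≤ α₁ + 1) :
    (∃ E₁, P.LRAStarEvaluates α₁ β E₁) ∧ (∃ E₂, P.LRAStarEvaluates α₂ β E₂) ∧
      ∀ E₁ E₂, P.LRAStarEvaluates α₁ β E₁ → P.LRAStarEvaluates α₂ β E₂ → E₁ ⊆ E₂ := by
  have hα₂ : α₂ ≠ 0 := by
    rintro rfl
    have : β ≤ 0 := by exact_mod_cast h₂β
    omega
  have hα₁ : α₁ ≠ 0 := (bot_le.trans_lt h₁₂).ne'
  refine ⟨P.exists_lraStarEvaluates hβ hα₁, P.exists_lraStarEvaluates hβ hα₂, ?_⟩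
  rintro _ _ ⟨S₀, S, hS₀, hS, -, rfl⟩ ⟨T₀, T, hT₀, hT, hhalt, rfl⟩
  obtain ⟨hT', hK, hJ⟩ := hT₀.invariants hP hα₂ hT
  -- The inclusion holds at every stage of the first run; only the second run has to have halted.
  suffices P.IsComplete α₁ S ∧ S.evaluated ⊆ T.evaluated from this.2
  clear hα₁
  induction hS with
  | refl => exact ⟨hS₀.isComplete, by simp [hS₀.1]⟩
  | tail _ h ih =>
    exact ⟨ih.1.iteration h, h.evaluated_subset hP hβ h₂β hα ih.1 hT' hK hJ hhalt ih.2⟩
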